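/- Let $M\ge 1$ be an integer, $p\in[0,1]$, $q\in(0,1)$, $0\le r<r'\le 1$, $C>0$ and $\lambda\in\mathbb R$. Put $\bar P_d=\binom Md\left[r^d(1-r)^{M-d}q+r'^d(1-r')^{M-d}(1-q)\right]$ for $0\le d\le M$, and for $x\in\{0,1,2,\dots\}$ let $P_d(x)=\bar P_d$ if $0\le d<\min(x,M)$ and $P_d(x)=\sum_{k=\min(x,M)}^{M}\bar P_k$ if $d=\min(x,M)$. Let $p_1=p$ and $p_0=1-p$. Consider the Markov decision process on $\{0,1,2,\dots\}$ in which, in state $x$ under control $u\in\{0,1\}$ ($u=1$: accept an arriving user, $u=0$: reject), the cost $Cx+(1-u)\lambda$ is incurred and the next state is $x-d+u\varsigma$ with probability $P_d(x)\,p_\varsigma$, for $0\le d\le\min(x,M)$ and $\varsigma\in\{0,1\}$. For $\alpha\in(0,1)$ let $$V^\alpha(x)=\inf_\pi \mathbb E\left[\sum_{n\ge 0}\alpha^n\bigl(CX_n+(1-u_n)\lambda\bigr)\,\Big|\,X_0=x\right],$$ the infimum being over the stationary policies $\pi$ (maps from states to controls, $u_n=\pi(X_n)$). Then the limits $V(x)=\lim_{\alpha\uparrow1}\bigl(V^\alpha(x)-V^\alpha(0)\bigr)$,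 for all $x$, and $\eta=\lim_{\alpha\uparrow1}(1-\alpha)V^\alpha(0)$ exist and are finite. They satisfy the average-cost dynamic programming equation $$V(x)=Cx-\eta+\min\left\{\sum_{\varsigma=0}^{1}\sum_{d=0}^{\min(x,M)}V(x-d+\varsigma)P_d(x)p_\varsigma\,;\ \lambda+\sum_{d=0}^{\min(x,M)}V(x-d)P_d(x)\right\},\qquad x\ge 0,$$ and the relative value function $V$ has non-decreasing differences: if $z,x_1,x_2$ are integers with $z>0$ and $x_1>x_2\ge0$, then $$V(x_1+z)-V(x_1)\ \ge\ V(x_2+z)-V(x_2).$$ -/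

import Mathlib

open Filter Topology

noncomputable section

/-- Parameters of the controlled queue at a single base station, for a given tax `lam`. -/
structure BaseStation where
  /-- number of mini-slots in a slot -/
  M : ℕ
  /-- probability that a user arrives in a slot -/
  p : ℝ
  /-- probability that the channel is jammed in a slot -/
  q : ℝ
  /-- departure probability per mini-slot in a jammed slot -/
  r : ℝ
  /-- departure probability per mini-slot in a slot that is not jammed -/
  r' : ℝ
  /-- holding cost per user and slot -/
  C : ℝ
  /-- the tax, paid in every slot in which the station does not accept -/
  lam : ℝ

namespace BaseStation

variable (B : BaseStation)

/-- The mixed binomial weight: the probability of `d` successes in `M` mini-slots. -/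
def binWeight (d : ℕ) : ℝ :=
  (B.M.choose d : ℝ) *
    (B.r ^ d * (1 - B.r) ^ (B.M - d) * B.q + B.r' ^ d * (1 - B.r') ^ (B.M - d) * (1 - B.q))

/-- The probability `P_d(x)` of `d` departures in a slot that starts with `x` users: at most
`min x M` users depart, and all weights from `min x M` on are lumped at `d = min x M`.
In particular `d = 0` has probability one (total weight) when `x = 0`. -/
def depProb (x d : ℕ) : ℝ :=
  if d < min x B.M then B.binWeight d
  else if d = min x B.M then ∑ k ∈ Finset.Icc (min x B.M) B.M, B.binWeight k
  else 0

/-- The probability of `s` arrivals in a slot, `s = 0, 1`. -/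
def arrProb (s : Fin 2) : ℝ := if s = 1 then B.p else 1 - B.p

/-- `∑_y p(y | x, u) f(y)`: the expectation of `f` at the next state `x - D + u * s`, from state
`x` under control `u` (`u = 1`: accept, `u = 0`: reject). -/
def nextExp (u : Fin 2) (f : ℕ → ℝ) (x : ℕ) : ℝ :=
  ∑ s : Fin 2, (∑ d ∈ Finset.range (min x B.M + 1),
    f (x - d + (u : ℕ) * (s : ℕ)) * B.depProb x d) * B.arrProb s

/-- The one-slot cost `C x + (1 - u) lam`. -/
def cost (x : ℕ) (u : Fin 2) : ℝ := B.C * x + (1 - ((u : ℕ) : ℝ)) * B.lam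

/-- `E[f(X_n) | X_0 = x]` for the Markov chain `X` induced by the stationary policy `π`, i.e. the
`n`-th power of its transition operator applied to `f`. -/
def expAt (π : ℕ → Fin 2) (n : ℕ) (f : ℕ → ℝ) : ℕ → ℝ :=
  (fun (g : ℕ → ℝ) (x : ℕ) => B.nextExp (π x) g x)^[n] f

/-- The discounted cost of the stationary policy `π` over an infinite horizon from state `x`:
`E[∑ₙ αⁿ (C X_n + (1 - u_n) lam) | X_0 = x]` with `u_n = π X_n`. -/
def discCost (α : ℝ) (π : ℕ → Fin 2) (x : ℕ) : ℝ :=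
  ∑' n : ℕ, α ^ n * B.expAt π n (fun y => B.cost y (π y)) x

/-- The discounted value function: the least discounted cost over all stationary policies. -/
def discValue (α : ℝ) (x : ℕ) : ℝ := ⨅ π : ℕ → Fin 2, B.discCost α π x

/-- The relative value function `V` of the average-cost problem,
`V(x) = lim_{α ↑ 1} (V^α(x) - V^α(0))`. -/
def relValue (x : ℕ) : ℝ :=
  limUnder (𝓝[<] (1 : ℝ)) (fun α => B.discValue α x - B.discValue α 0)

/-- The constant `η = lim_{α ↑ 1} (1 - α) V^α(0)`. -/
def eta : ℝ := limUnder (𝓝[<] (1 : ℝ)) (fun α => (1 - α) * B.discValue α 0)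

/-- `(V, η)` solves the average-cost dynamic programming equation. -/
def SolvesDPE (V : ℕ → ℝ) (η : ℝ) : Prop :=
  ∀ x : ℕ, V x = B.C * x - η + min (B.nextExp 1 V x) (B.lam + B.nextExp 0 V x)

end BaseStation

end

/-! The next state is `(x - D)⁺ + u ς`, where the law `binWeight` of `D` does not depend on `x`.
Running neighbouring states with the same `D` and `ς` gives the estimates below.

For fixed `α`, the Bellman operator preserves non-decreasing convex functions
(`bellman_monoConvex`): the actions optimal at `x` and at `x + 2` can both be tried at `x + 1`.
Value iteration therefore converges to a convex fixed point, and a comparison argument identifies it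
with `V^α` (`discValue_spec`).

The main difficulty is that the full limits exist, not merely subsequential ones. Increments of
`V^α` far from the origin are large (`discValue_succ_sub_ge`), so if `p > 0` rejection is optimal
beyond a threshold common to all `α` near 1; if `p = 0` the control does not affect the motion
(`exists_tail_action`). Hence finitely many policies suffice. From a given state each of them lives
on finitely many states, so its cost solves a finite linear system and is rational in `α`. A minimum
of finitely many such functions is again rational near 1 (`discValue_eventuallyRational`), and a
bounded rational function has a limit. The bounds are `discValue_sub_bounds` and
`abs_one_sub_mul_discValue_zero_le`. The equation and the convexity then pass to the limit. -/

namespace BaseStation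

variable (B : BaseStation)

/-- The standing assumptions on the parameters that the analysis uses. -/
structure Admissible : Prop where
  one_le_M : 1 ≤ B.M
  p_nonneg : 0 ≤ B.p
  p_le_one : B.p ≤ 1
  q_nonneg : 0 ≤ B.q
  q_lt_one : B.q < 1
  r_nonneg : 0 ≤ B.r
  r_le_one : B.r ≤ 1
  r'_pos : 0 < B.r'
  r'_le_one : B.r' ≤ 1
  C_pos : 0 < B.C

/-! ### The transition operator. -/

variable {B}

/-- Truncated subtraction does the lumping: every `k ≥ min x M` with `k ≤ M` leads to the same state
`x - k`. The weights thus become independent of `x`. -/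
lemma sum_depProb (g : ℕ → ℝ) (x : ℕ) :
    ∑ d ∈ Finset.range (min x B.M + 1), g (x - d) * B.depProb x d =
      ∑ k ∈ Finset.range (B.M + 1), g (x - k) * B.binWeight k := by
  have hm : min x B.M ≤ B.M + 1 := (min_le_right _ _).trans (Nat.le_succ _)
  rw [Finset.sum_range_succ, ← Finset.sum_range_add_sum_Ico _ hm]
  congr 1
  · refine Finset.sum_congr rfl fun d hd => ?_
    rw [depProb, if_pos (Finset.mem_range.mp hd)]
  · rw [depProb, if_neg (lt_irrefl _), if_pos rfl, Finset.mul_sum]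
    refine Finset.sum_congr rfl fun k hk => ?_
    have hk' := Finset.mem_Icc.mp hk
    have : x - min x B.M = x - k := by omega
    rw [this]

lemma nextExp_eq (u : Fin 2) (f : ℕ → ℝ) (x : ℕ) :
    B.nextExp u f x = ∑ s : Fin 2, ∑ k ∈ Finset.range (B.M + 1),
      (B.binWeight k * B.arrProb s) * f (x - k + (u : ℕ) * (s : ℕ)) := by
  unfold nextExp
  refine Finset.sum_congr rfl fun s _ => ?_
  rw [sum_depProb (fun y => f (y + (u : ℕ) * (s : ℕ))) x, Finset.sum_mul]
  exact Finset.sum_congr rfl fun k _ => by ring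

lemma nextExp_zero_eq (f : ℕ → ℝ) (x : ℕ) :
    B.nextExp 0 f x = ∑ k ∈ Finset.range (B.M + 1), B.binWeight k * f (x - k) := by
  rw [nextExp_eq, Fin.sum_univ_two, ← Finset.sum_add_distrib]
  refine Finset.sum_congr rfl fun k _ => ?_
  simp [arrProb]
  ring

lemma nextExp_one_sub_zero (f : ℕ → ℝ) (x : ℕ) :
    B.nextExp 1 f x - B.nextExp 0 f x =
      B.p * ∑ k ∈ Finset.range (B.M + 1), B.binWeight k * (f (x - k + 1) - f (x - k)) := by
  rw [nextExp_zero_eq, nextExp_eq, Fin.sum_univ_two, ← Finset.sum_add_distrib,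
    ← Finset.sum_sub_distrib, Finset.mul_sum]
  refine Finset.sum_congr rfl fun k _ => ?_
  simp [arrProb]
  ring

lemma sum_binWeight : ∑ k ∈ Finset.range (B.M + 1), B.binWeight k = 1 := by
  have h (t : ℝ) : ∑ k ∈ Finset.range (B.M + 1),
      (B.M.choose k : ℝ) * (t ^ k * (1 - t) ^ (B.M - k)) = 1 := by
    have := add_pow t (1 - t) B.M
    rw [add_sub_cancel, one_pow] at this
    exact (Finset.sum_congr rfl fun k _ => by ring).trans this.symm
  calc _ = ∑ k ∈ Finset.range (B.M + 1),
        (((B.M.choose k : ℝ) * (B.r ^ k * (1 - B.r) ^ (B.M - k))) * B.q +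
        ((B.M.choose k : ℝ) * (B.r' ^ k * (1 - B.r') ^ (B.M - k))) * (1 - B.q)) :=
        Finset.sum_congr rfl fun k _ => by rw [binWeight]; ring
    _ = 1 := by
        rw [Finset.sum_add_distrib, ← Finset.sum_mul, ← Finset.sum_mul, h, h]; ring

lemma sum_arrProb : ∑ s : Fin 2, B.arrProb s = 1 := by
  simp [arrProb]

lemma nextExp_const (u : Fin 2) (a : ℝ) (x : ℕ) : B.nextExp u (fun _ => a) x = a := by
  simp_rw [nextExp_eq, ← Finset.sum_mul, sum_binWeight, one_mul, sum_arrProb, one_mul]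

lemma nextExp_const_mul (u : Fin 2) (a : ℝ) (f : ℕ → ℝ) (x : ℕ) :
    B.nextExp u (fun y => a * f y) x = a * B.nextExp u f x := by
  simp_rw [nextExp_eq, Finset.mul_sum]
  exact Finset.sum_congr rfl fun s _ => Finset.sum_congr rfl fun k _ => by ring

lemma nextExp_neg (u : Fin 2) (f : ℕ → ℝ) (x : ℕ) :
    B.nextExp u (fun y => -f y) x = -B.nextExp u f x := by
  simpa using nextExp_const_mul (B := B) u (-1) f x

lemma nextExp_sub (u : Fin 2) (f g : ℕ → ℝ) (x : ℕ) :
    B.nextExp u (fun y => f y - g y) x = B.nextExp u f x - B.nextExp u g x := by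
  simp_rw [nextExp_eq, mul_sub, Finset.sum_sub_distrib]

lemma nextExp_tendsto {ι : Type*} {l : Filter ι} {F : ι → ℕ → ℝ} {f : ℕ → ℝ}
    (h : ∀ y, Tendsto (fun i => F i y) l (𝓝 (f y))) (u : Fin 2) (x : ℕ) :
    Tendsto (fun i => B.nextExp u (F i) x) l (𝓝 (B.nextExp u f x)) := by
  simp_rw [nextExp_eq]
  exact tendsto_finsetSum _ fun s _ => tendsto_finsetSum _ fun k _ => (h _).const_mul _

lemma nextExp_hasSum {F : ℕ → ℕ → ℝ} {f : ℕ → ℝ}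
    (h : ∀ y, HasSum (fun i => F i y) (f y)) (u : Fin 2) (x : ℕ) :
    HasSum (fun i => B.nextExp u (F i) x) (B.nextExp u f x) := by
  simp_rw [nextExp_eq]
  exact hasSum_sum fun s _ => hasSum_sum fun k _ => (h _).mul_left _

/-- The states up to `N` can only be left by an accepted arrival at `N` itself, which `hu` excludes
or gives weight zero. -/
lemma nextExp_congr {N : ℕ} {u : Fin 2} {x : ℕ} (hx : x ≤ N)
    (hu : x = N → u = 0 ∨ B.p = 0) {f g : ℕ → ℝ} (hfg : ∀ y ≤ N, f y = g y) :
    B.nextExp u f x = B.nextExp u g x := by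
  rw [nextExp_eq, nextExp_eq]
  refine Finset.sum_congr rfl fun s _ => Finset.sum_congr rfl fun k _ => ?_
  by_cases hle : x - k + (u : ℕ) * (s : ℕ) ≤ N
  · rw [hfg _ hle]
  · have hus : (u : ℕ) * (s : ℕ) ≤ 1 := by
      fin_cases u <;> fin_cases s <;> simp
    have hxN : x = N := by omega
    rcases hu hxN with rfl | hp
    · simp at hle; omega
    · have hs : s = 1 := by
        fin_cases s
        · simp at hle; omega
        · rfl
      simp [arrProb, hs, hp]

/-! ### Linear growth, policy evaluation and comparison. -/

namespace Admissible

variable (hB : B.Admissible)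
include hB

lemma binWeight_nonneg (k : ℕ) : 0 ≤ B.binWeight k := by
  have := hB.q_nonneg
  have := hB.r_nonneg
  have := hB.r'_pos.le
  have : 0 ≤ 1 - B.q := sub_nonneg.mpr hB.q_lt_one.le
  have : 0 ≤ 1 - B.r := sub_nonneg.mpr hB.r_le_one
  have : 0 ≤ 1 - B.r' := sub_nonneg.mpr hB.r'_le_one
  unfold binWeight
  positivity

lemma arrProb_nonneg (s : Fin 2) : 0 ≤ B.arrProb s := by
  unfold arrProb
  split_ifs
  · exact hB.p_nonneg
  · exact sub_nonneg.mpr hB.p_le_one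

/-- A slot is unjammed with positive probability, and then a departure has positive probability.
This makes `1 - binWeight 0` a legitimate denominator in `discValue_succ_sub_le`. -/
lemma binWeight_zero_lt_one : B.binWeight 0 < 1 := by
  have h1 : (1 - B.r) ^ B.M ≤ 1 :=
    pow_le_one₀ (sub_nonneg.mpr hB.r_le_one) (by linarith [hB.r_nonneg])
  have h2 : (1 - B.r') ^ B.M < 1 :=
    pow_lt_one₀ (sub_nonneg.mpr hB.r'_le_one) (by linarith [hB.r'_pos])
      (Nat.one_le_iff_ne_zero.mp hB.one_le_M)
  have h3 := mul_le_mul_of_nonneg_right h1 hB.q_nonneg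
  have h4 := mul_lt_mul_of_pos_right h2 (sub_pos.mpr hB.q_lt_one)
  simp only [binWeight, Nat.choose_zero_right, Nat.cast_one, pow_zero, Nat.sub_zero, one_mul]
  linarith

lemma nextExp_mono (u : Fin 2) {f g : ℕ → ℝ} (hfg : ∀ y, f y ≤ g y) (x : ℕ) :
    B.nextExp u f x ≤ B.nextExp u g x := by
  rw [nextExp_eq, nextExp_eq]
  exact Finset.sum_le_sum fun s _ => Finset.sum_le_sum fun k _ =>
    mul_le_mul_of_nonneg_left (hfg _) (mul_nonneg (hB.binWeight_nonneg k) (hB.arrProb_nonneg s))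

lemma nextExp_monotone (u : Fin 2) {f : ℕ → ℝ} (hf : Monotone f) : Monotone (B.nextExp u f) := by
  intro x y hxy
  rw [nextExp_eq, nextExp_eq]
  exact Finset.sum_le_sum fun s _ => Finset.sum_le_sum fun k _ =>
    mul_le_mul_of_nonneg_left (hf (by omega))
      (mul_nonneg (hB.binWeight_nonneg k) (hB.arrProb_nonneg s))

lemma nextExp_affine_le (u : Fin 2) {a b : ℝ} (hb : 0 ≤ b) (x : ℕ) :
    B.nextExp u (fun y => a + b * y) x ≤ a + b * (x + (u : ℕ)) := by
  have h : B.nextExp u (fun y => a + b * y) x ≤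
      ∑ s : Fin 2, ∑ k ∈ Finset.range (B.M + 1),
        (B.binWeight k * B.arrProb s) * (a + b * (x + (u : ℕ))) := by
    rw [nextExp_eq]
    refine Finset.sum_le_sum fun s _ => Finset.sum_le_sum fun k _ => ?_
    refine mul_le_mul_of_nonneg_left ?_
      (mul_nonneg (hB.binWeight_nonneg k) (hB.arrProb_nonneg s))
    have h1 : x - k + (u : ℕ) * (s : ℕ) ≤ x + (u : ℕ) := by
      have : (u : ℕ) * (s : ℕ) ≤ (u : ℕ) * 1 := Nat.mul_le_mul_left _ (by omega)
      omega
    have h2 : ((x - k + (u : ℕ) * (s : ℕ) : ℕ) : ℝ) ≤ x + (u : ℕ) := by exact_mod_cast h1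
    gcongr
  refine h.trans_eq ?_
  have := nextExp_const (B := B) u (a + b * (x + (u : ℕ))) x
  rwa [nextExp_eq] at this

lemma abs_nextExp_le (u : Fin 2) (f : ℕ → ℝ) (x : ℕ) :
    |B.nextExp u f x| ≤ B.nextExp u (fun y => |f y|) x := by
  refine abs_le.mpr ⟨?_, hB.nextExp_mono u (fun y => le_abs_self _) x⟩
  rw [← nextExp_neg]
  exact hB.nextExp_mono u (fun y => neg_abs_le _) x

/-- The queue grows by at most one user per slot. -/
lemma abs_expAt_le (π : ℕ → Fin 2) {f : ℕ → ℝ} {a b : ℝ} (hb : 0 ≤ b)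
    (hf : ∀ y : ℕ, |f y| ≤ a + b * y) (n x : ℕ) :
    |B.expAt π n f x| ≤ a + b * (x + n) := by
  induction n generalizing x with
  | zero => simpa [expAt] using hf x
  | succ n ih =>
    have h1 : B.expAt π (n + 1) f x = B.nextExp (π x) (B.expAt π n f) x :=
      congrFun (Function.iterate_succ_apply' _ n f) x
    rw [h1]
    calc |B.nextExp (π x) (B.expAt π n f) x|
        ≤ B.nextExp (π x) (fun y => |B.expAt π n f y|) x := hB.abs_nextExp_le _ _ _
      _ ≤ B.nextExp (π x) (fun y : ℕ => (a + b * n) + b * y) x :=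
          hB.nextExp_mono _ (fun y => (ih y).trans_eq (by ring)) x
      _ ≤ (a + b * n) + b * (x + (π x : ℕ)) := hB.nextExp_affine_le _ hb _
      _ ≤ a + b * (x + (n + 1 : ℕ)) := by
          have : ((π x : ℕ) : ℝ) ≤ 1 := by exact_mod_cast (show (π x : ℕ) ≤ 1 by omega)
          have := mul_le_mul_of_nonneg_left this hb
          push_cast
          linarith

lemma abs_cost_le (x : ℕ) (u : Fin 2) : |B.cost x u| ≤ |B.lam| + B.C * x := by
  have h1 : |B.C * (x : ℝ)| = B.C * x := abs_of_nonneg (mul_nonneg hB.C_pos.le x.cast_nonneg)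
  have h2 : |(1 - ((u : ℕ) : ℝ)) * B.lam| ≤ |B.lam| := by
    fin_cases u <;> simp
  calc |B.cost x u| ≤ |B.C * (x : ℝ)| + |(1 - ((u : ℕ) : ℝ)) * B.lam| := abs_add_le _ _
    _ ≤ _ := by rw [h1]; linarith

lemma abs_discount_term_le (α : ℝ) (hα : 0 ≤ α) (π : ℕ → Fin 2) (x n : ℕ) :
    ‖α ^ n * B.expAt π n (fun y => B.cost y (π y)) x‖ ≤
      (|B.lam| + B.C * x) * α ^ n + B.C * ((n : ℝ) ^ 1 * α ^ n) := by
  rw [Real.norm_eq_abs, abs_mul, abs_of_nonneg (pow_nonneg hα n)]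
  refine (mul_le_mul_of_nonneg_left (hB.abs_expAt_le π hB.C_pos.le
    (fun y => hB.abs_cost_le y (π y)) n x) (pow_nonneg hα n)).trans_eq ?_
  ring

/-- Ensures that the `∑'` in `discCost` is a genuine sum and not the default value 0. -/
lemma summable_discount {α : ℝ} (hα : 0 ≤ α) (hα1 : α < 1) (π : ℕ → Fin 2) (x : ℕ) :
    Summable fun n : ℕ => α ^ n * B.expAt π n (fun y => B.cost y (π y)) x := by
  have hn : ‖α‖ < 1 := by rwa [Real.norm_eq_abs, abs_of_nonneg hα]
  exact Summable.of_norm_bounded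
    (((summable_geometric_of_lt_one hα hα1).mul_left _).add
      ((summable_pow_mul_geometric_of_norm_lt_one 1 hn).mul_left _))
    (hB.abs_discount_term_le α hα π x)

lemma abs_discCost_le {α : ℝ} (hα : 0 ≤ α) (hα1 : α < 1) (π : ℕ → Fin 2) :
    ∃ a b : ℝ, 0 ≤ b ∧ ∀ x : ℕ, |B.discCost α π x| ≤ a + b * x := by
  have hn : ‖α‖ < 1 := by rwa [Real.norm_eq_abs, abs_of_nonneg hα]
  have hg := summable_geometric_of_lt_one hα hα1
  have hk := summable_pow_mul_geometric_of_norm_lt_one 1 hn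
  refine ⟨|B.lam| * ∑' n : ℕ, α ^ n + B.C * ∑' n : ℕ, (n : ℝ) ^ 1 * α ^ n,
    B.C * ∑' n : ℕ, α ^ n, mul_nonneg hB.C_pos.le (tsum_nonneg fun n => pow_nonneg hα n),
    fun x => ?_⟩
  refine (tsum_of_norm_bounded ((hg.hasSum.mul_left _).add (hk.hasSum.mul_left _))
    (hB.abs_discount_term_le α hα π x)).trans_eq ?_
  ring

lemma discCost_eq {α : ℝ} (hα : 0 ≤ α) (hα1 : α < 1) (π : ℕ → Fin 2) (x : ℕ) :
    B.discCost α π x = B.cost x (π x) + α * B.nextExp (π x) (B.discCost α π) x := by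
  have hs := hB.summable_discount hα hα1 π
  have h2 := (nextExp_hasSum (B := B) (fun y => (hs y).hasSum) (π x) x).mul_left α
  unfold discCost
  rw [(hs x).tsum_eq_zero_add]
  congr 1
  · simp [expAt]
  · rw [← h2.tsum_eq]
    refine tsum_congr fun n => ?_
    rw [nextExp_const_mul, pow_succ']
    have h1 : B.expAt π (n + 1) (fun y => B.cost y (π y)) x =
        B.nextExp (π x) (B.expAt π n fun y => B.cost y (π y)) x :=
      congrFun (Function.iterate_succ_apply' _ n _) x
    rw [h1, mul_assoc]

/-- A function of at most linear growth that is dominated by its discounted expectation at the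
next state is nonpositive. -/
lemma nonpos_of_le_discounted {α : ℝ} (hα : 0 ≤ α) (hα1 : α < 1) (π : ℕ → Fin 2) {f : ℕ → ℝ}
    {a b : ℝ} (hb : 0 ≤ b) (hf : ∀ x : ℕ, f x ≤ a + b * x)
    (h : ∀ x, f x ≤ α * B.nextExp (π x) f x) (x : ℕ) : f x ≤ 0 := by
  -- Iterating the hypothesis `n` times costs only linear growth in `n`, which the factor `α ^ n`
  -- beats.
  have key : ∀ n x : ℕ, f x ≤ α ^ n * (a + b * (x + n)) := by
    intro n
    induction n with
    | zero => intro x; simpa using hf x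
    | succ n ih =>
      intro x
      have h1 : B.nextExp (π x) f x ≤ α ^ n * (a + b * (x + (n + 1))) := by
        calc B.nextExp (π x) f x
            ≤ B.nextExp (π x) (fun y : ℕ => α ^ n * ((a + b * n) + b * y)) x :=
              hB.nextExp_mono _ (fun y => (ih y).trans_eq (by ring)) x
          _ = α ^ n * B.nextExp (π x) (fun y : ℕ => (a + b * n) + b * y) x :=
              nextExp_const_mul _ _ _ _
          _ ≤ α ^ n * ((a + b * n) + b * (x + (π x : ℕ))) :=
              mul_le_mul_of_nonneg_left (hB.nextExp_affine_le _ hb _) (pow_nonneg hα n)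
          _ ≤ α ^ n * (a + b * (x + (n + 1))) := by
              have : ((π x : ℕ) : ℝ) ≤ 1 := by exact_mod_cast (show (π x : ℕ) ≤ 1 by omega)
              have := mul_le_mul_of_nonneg_left this hb
              exact mul_le_mul_of_nonneg_left (by linarith) (pow_nonneg hα n)
      calc f x ≤ α * B.nextExp (π x) f x := h x
        _ ≤ α * (α ^ n * (a + b * (x + (n + 1)))) := mul_le_mul_of_nonneg_left h1 hα
        _ = _ := by push_cast; ring
  have hn : ‖α‖ < 1 := by rwa [Real.norm_eq_abs, abs_of_nonneg hα]
  have h1 := ((summable_geometric_of_lt_one hα hα1).mul_left (a + b * x)).add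
    ((summable_pow_mul_geometric_of_norm_lt_one 1 hn).mul_left b)
  refine ge_of_tendsto' h1.tendsto_atTop_zero fun n => (key n x).trans_eq ?_
  ring

end Admissible

/-! ### Convexity, value iteration and verification. -/

/-- A non-decreasing function with non-decreasing increments. -/
structure MonoConvex (f : ℕ → ℝ) : Prop where
  mono : Monotone f
  incr : Monotone fun x => f (x + 1) - f x

/-- For `k ≤ x` this compares the increments at `x - k + i` and `x + 1 - k + j`, which are in order
because `i ≤ 1`. For `k > x` truncation makes `x - k` and `x + 1 - k` both zero, and monotonicity is
what remains to be used. -/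
lemma MonoConvex.exchange {f : ℕ → ℝ} (hf : MonoConvex f) (x k : ℕ) {i j : ℕ} (hi : i ≤ 1) :
    f (x + 1 - k + i) + f (x + 1 - k + j) ≤ f (x - k + i) + f (x + 2 - k + j) := by
  rcases le_or_gt k x with hk | hk
  · have h1 : x + 1 - k + i = (x - k + i) + 1 := by omega
    have h2 : x + 2 - k + j = (x + 1 - k + j) + 1 := by omega
    have h3 := hf.incr (show x - k + i ≤ x + 1 - k + j by omega)
    simp only at h3
    rw [h1, h2]
    rw [← h1] at h3 ⊢
    linarith
  · have h1 : x + 1 - k = x - k := by omega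
    rw [h1]
    have := hf.mono (show x - k + j ≤ x + 2 - k + j by omega)
    linarith

/-- The discounted Bellman operator. -/
noncomputable def bellman (B : BaseStation) (α : ℝ) (f : ℕ → ℝ) (x : ℕ) : ℝ :=
  B.C * x + min (α * B.nextExp 1 f x) (B.lam + α * B.nextExp 0 f x)

lemma bellman_le (α : ℝ) (f : ℕ → ℝ) (x : ℕ) (u : Fin 2) :
    B.bellman α f x ≤ B.cost x u + α * B.nextExp u f x := by
  have h1 := min_le_left (α * B.nextExp 1 f x) (B.lam + α * B.nextExp 0 f x)
  have h2 := min_le_right (α * B.nextExp 1 f x) (B.lam + α * B.nextExp 0 f x)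
  unfold bellman cost
  fin_cases u
  · simp; linarith
  · simp

lemma exists_bellman_eq (α : ℝ) (f : ℕ → ℝ) (x : ℕ) :
    ∃ u : Fin 2, B.bellman α f x = B.cost x u + α * B.nextExp u f x := by
  unfold bellman cost
  rcases min_choice (α * B.nextExp 1 f x) (B.lam + α * B.nextExp 0 f x) with h | h
  · exact ⟨1, by rw [h]; simp⟩
  · exact ⟨0, by rw [h]; simp; ring⟩

lemma monoConvex_of_tendsto {F : ℕ → ℕ → ℝ} {f : ℕ → ℝ} (hF : ∀ n, MonoConvex (F n))
    (h : ∀ x, Tendsto (fun n => F n x) atTop (𝓝 (f x))) : MonoConvex f where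
  mono x y hxy := le_of_tendsto_of_tendsto' (h x) (h y) fun n => (hF n).mono hxy
  incr x y hxy := le_of_tendsto_of_tendsto' ((h (x + 1)).sub (h x)) ((h (y + 1)).sub (h y))
    fun n => (hF n).incr hxy

namespace Admissible

variable (hB : B.Admissible)
include hB

lemma nextExp_exchange {f : ℕ → ℝ} (hf : MonoConvex f) (u u' : Fin 2) (x : ℕ) :
    B.nextExp u f (x + 1) + B.nextExp u' f (x + 1) ≤
      B.nextExp u f x + B.nextExp u' f (x + 2) := by
  simp_rw [nextExp_eq, ← Finset.sum_add_distrib, ← mul_add]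
  refine Finset.sum_le_sum fun s _ => Finset.sum_le_sum fun k _ =>
    mul_le_mul_of_nonneg_left (hf.exchange x k ?_)
      (mul_nonneg (hB.binWeight_nonneg k) (hB.arrProb_nonneg s))
  fin_cases u <;> fin_cases s <;> simp

lemma bellman_mono {α : ℝ} (hα : 0 ≤ α) {f g : ℕ → ℝ} (hfg : ∀ y, f y ≤ g y) (x : ℕ) :
    B.bellman α f x ≤ B.bellman α g x := by
  have h0 := mul_le_mul_of_nonneg_left (hB.nextExp_mono 0 hfg x) hα
  have h1 := mul_le_mul_of_nonneg_left (hB.nextExp_mono 1 hfg x) hα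
  unfold bellman
  gcongr

lemma bellman_monoConvex {α : ℝ} (hα : 0 ≤ α) {f : ℕ → ℝ} (hf : MonoConvex f) :
    MonoConvex (B.bellman α f) where
  mono x y hxy := by
    have h0 := mul_le_mul_of_nonneg_left (hB.nextExp_monotone 0 hf.mono hxy) hα
    have h1 := mul_le_mul_of_nonneg_left (hB.nextExp_monotone 1 hf.mono hxy) hα
    have h2 : B.C * x ≤ B.C * y := mul_le_mul_of_nonneg_left (by exact_mod_cast hxy) hB.C_pos.le
    unfold bellman
    gcongr
  incr := by
    refine monotone_nat_of_le_succ fun x => ?_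
    -- The minimizers at the two outer points serve as competitors at the middle point; the linear
    -- cost and the tax cancel.
    obtain ⟨u, hu⟩ := exists_bellman_eq (B := B) α f x
    obtain ⟨u', hu'⟩ := exists_bellman_eq (B := B) α f (x + 2)
    have h1 := bellman_le (B := B) α f (x + 1) u
    have h2 := bellman_le (B := B) α f (x + 1) u'
    have h3 := mul_le_mul_of_nonneg_left (hB.nextExp_exchange hf u u' x) hα
    simp only [show x + 1 + 1 = x + 2 from rfl]
    rw [hu, hu']
    simp only [cost] at h1 h2 ⊢
    push_cast at h1 h2 ⊢
    linarith

/-- The discounted value function is a fixed point of the Bellman operator, obtained as the limit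
of value iteration from the constant `-|lam| / (1 - α)`. -/
lemma exists_bellman_fixedPoint {α : ℝ} (hα : 0 ≤ α) (hα1 : α < 1) :
    ∃ W : ℕ → ℝ, MonoConvex W ∧ (∀ x, W x = B.bellman α W x) ∧
      ∀ x : ℕ, |W x| ≤ |B.lam| / (1 - α) + B.C / (1 - α) * x := by
  have hα' : 0 < 1 - α := sub_pos.mpr hα1
  have hl : |B.lam| / (1 - α) * (1 - α) = |B.lam| := div_mul_cancel₀ _ hα'.ne'
  have hc : B.C / (1 - α) * (1 - α) = B.C := div_mul_cancel₀ _ hα'.ne'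
  have hl0 : 0 ≤ |B.lam| / (1 - α) := by positivity
  have hc0 : 0 ≤ B.C / (1 - α) := div_nonneg hB.C_pos.le hα'.le
  set l := |B.lam| / (1 - α)
  set c := B.C / (1 - α)
  let F : ℕ → ℕ → ℝ := fun n => (B.bellman α)^[n] fun _ => -l
  have hF : ∀ n, F (n + 1) = B.bellman α (F n) := fun n => Function.iterate_succ_apply' _ _ _
  have hconv : ∀ n, MonoConvex (F n) := by
    intro n
    induction n with
    | zero => exact ⟨monotone_const, fun _ _ _ => by simp [F]⟩
    | succ n ih => rw [hF]; exact hB.bellman_monoConvex hα ih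
  -- The start `-l` is a subsolution because `(1 - α) l = |lam|`.
  have hmono : ∀ n x, F n x ≤ F (n + 1) x := by
    intro n
    induction n with
    | zero =>
      intro x
      rw [hF]
      simp only [F, Function.iterate_zero, id, bellman, nextExp_const]
      have h0 : 0 ≤ B.C * (x : ℝ) := mul_nonneg hB.C_pos.le x.cast_nonneg
      have h1 : -l ≤ min (α * -l) (B.lam + α * -l) :=
        le_min (by nlinarith) (by nlinarith [neg_abs_le B.lam])
      linarith
    | succ n ih =>
      intro x
      rw [hF n, hF (n + 1)]
      exact hB.bellman_mono hα ih x
  -- Always rejecting preserves this bound: `(1 - α) l = |lam|` pays the tax and `(1 - α) c = C` the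
  -- holding cost.
  have hub : ∀ n (x : ℕ), F n x ≤ l + c * x := by
    intro n
    induction n with
    | zero =>
      intro x
      have : 0 ≤ c * (x : ℝ) := by positivity
      simp only [F, Function.iterate_zero, id]
      linarith
    | succ n ih =>
      intro x
      rw [hF]
      have h1 := hB.nextExp_mono 0 ih x
      have h2 := hB.nextExp_affine_le 0 hc0 (a := l) x
      have h3 := mul_le_mul_of_nonneg_left (h1.trans h2) hα
      have h4 := bellman_le (B := B) α (F n) x 0
      simp [cost] at h3 h4
      have h5 : B.C * x = c * x * (1 - α) := by rw [← hc]; ring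
      nlinarith [le_abs_self B.lam]
  have hmono' : ∀ x, Monotone fun n => F n x := fun x => monotone_nat_of_le_succ (hmono · x)
  have hlim : ∀ x, Tendsto (fun n => F n x) atTop (𝓝 (⨆ n, F n x)) := fun x =>
    tendsto_atTop_ciSup (hmono' x) ⟨l + c * x, by rintro _ ⟨n, rfl⟩; exact hub n x⟩
  refine ⟨fun x => ⨆ n, F n x, monoConvex_of_tendsto hconv hlim, fun x => ?_, fun x => ?_⟩
  · refine tendsto_nhds_unique ((hlim x).comp (tendsto_add_atTop_nat 1)) ?_
    simp only [Function.comp_def, hF]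
    exact (((nextExp_tendsto hlim 1 x).const_mul α).min
      (((nextExp_tendsto hlim 0 x).const_mul α).const_add _)).const_add _
  · have : 0 ≤ c * (x : ℝ) := by positivity
    refine abs_le.mpr ⟨?_, le_of_tendsto' (hlim x) (hub · x)⟩
    refine ge_of_tendsto' (hlim x) fun n => ?_
    have h0 : F 0 x ≤ F n x := hmono' x (Nat.zero_le n)
    have h1 : F 0 x = -l := rfl
    linarith

/-- Verification: a fixed point of the Bellman operator of at most linear growth is the value
function, and a policy choosing minimizers attains it. -/
lemma discCost_eq_of_greedy {α : ℝ} (hα : 0 ≤ α) (hα1 : α < 1) {W : ℕ → ℝ} {a b : ℝ}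
    (hb : 0 ≤ b) (hW : ∀ x : ℕ, |W x| ≤ a + b * x) {π : ℕ → Fin 2}
    (h : ∀ x, W x = B.cost x (π x) + α * B.nextExp (π x) W x) (x : ℕ) :
    B.discCost α π x = W x := by
  obtain ⟨a', b', hb', hab'⟩ := hB.abs_discCost_le hα hα1 π
  have h1 := hB.nonpos_of_le_discounted hα hα1 π (f := fun y => W y - B.discCost α π y)
    (a := a + a') (b := b + b') (add_nonneg hb hb')
    (fun y => by linarith [(abs_le.mp (hW y)).2, (abs_le.mp (hab' y)).1])
    (fun y => by
      rw [nextExp_sub]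
      linarith [h y, hB.discCost_eq hα hα1 π y]) x
  have h2 := hB.nonpos_of_le_discounted hα hα1 π (f := fun y => B.discCost α π y - W y)
    (a := a + a') (b := b + b') (add_nonneg hb hb')
    (fun y => by linarith [(abs_le.mp (hW y)).1, (abs_le.mp (hab' y)).2])
    (fun y => by
      rw [nextExp_sub]
      linarith [h y, hB.discCost_eq hα hα1 π y]) x
  linarith

lemma le_discCost_of_bellman {α : ℝ} (hα : 0 ≤ α) (hα1 : α < 1) {W : ℕ → ℝ} {a b : ℝ}
    (hb : 0 ≤ b) (hW : ∀ x : ℕ, |W x| ≤ a + b * x) (h : ∀ x, W x = B.bellman α W x)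
    (π : ℕ → Fin 2) (x : ℕ) : W x ≤ B.discCost α π x := by
  obtain ⟨a', b', hb', hab'⟩ := hB.abs_discCost_le hα hα1 π
  have h1 := hB.nonpos_of_le_discounted hα hα1 π (f := fun y => W y - B.discCost α π y)
    (a := a + a') (b := b + b') (add_nonneg hb hb')
    (fun y => by linarith [(abs_le.mp (hW y)).2, (abs_le.mp (hab' y)).1])
    (fun y => by
      rw [nextExp_sub]
      linarith [h y, bellman_le (B := B) α W y (π y), hB.discCost_eq hα hα1 π y]) x
  linarith

lemma discValue_eq_of_bellman {α : ℝ} (hα : 0 ≤ α) (hα1 : α < 1) {W : ℕ → ℝ} {a b : ℝ}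
    (hb : 0 ≤ b) (hW : ∀ x : ℕ, |W x| ≤ a + b * x) (h : ∀ x, W x = B.bellman α W x) (x : ℕ) :
    B.discValue α x = W x := by
  have hle := hB.le_discCost_of_bellman hα hα1 hb hW h
  choose π hπ using exists_bellman_eq (B := B) α W
  refine le_antisymm ?_ (le_ciInf fun π => hle π x)
  -- A real infimum is meaningful only with a lower bound, here `W x`.
  refine (ciInf_le ⟨W x, by rintro _ ⟨π, rfl⟩; exact hle π x⟩ π).trans_eq ?_
  exact hB.discCost_eq_of_greedy hα hα1 hb hW (fun y => (h y).trans (hπ y)) x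

/-! ### Bounds on the discounted values and their increments. -/

section Discounted

variable {α : ℝ} (hα : 0 ≤ α) (hα1 : α < 1)
include hα hα1

lemma discValue_spec : MonoConvex (B.discValue α) ∧
    (∀ x, B.discValue α x = B.bellman α (B.discValue α) x) ∧
      ∀ x : ℕ, |B.discValue α x| ≤ |B.lam| / (1 - α) + B.C / (1 - α) * x := by
  obtain ⟨W, h1, h2, h3⟩ := hB.exists_bellman_fixedPoint hα hα1
  have hc0 : 0 ≤ B.C / (1 - α) := div_nonneg hB.C_pos.le (sub_pos.mpr hα1).le
  have : B.discValue α = W := funext (hB.discValue_eq_of_bellman hα hα1 hc0 h3 h2)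
  rw [this]
  exact ⟨h1, h2, h3⟩

lemma discCost_eq_discValue {π : ℕ → Fin 2}
    (h : ∀ x, B.discValue α x =
      B.cost x (π x) + α * B.nextExp (π x) (B.discValue α) x) (x : ℕ) :
    B.discCost α π x = B.discValue α x :=
  hB.discCost_eq_of_greedy hα hα1 (div_nonneg hB.C_pos.le (sub_pos.mpr hα1).le)
    (hB.discValue_spec hα hα1).2.2 h x

lemma discValue_le_discCost (π : ℕ → Fin 2) (x : ℕ) : B.discValue α x ≤ B.discCost α π x :=
  hB.le_discCost_of_bellman hα hα1 (div_nonneg hB.C_pos.le (sub_pos.mpr hα1).le)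
    (hB.discValue_spec hα hα1).2.2 (hB.discValue_spec hα hα1).2.1 π x

lemma abs_one_sub_mul_discValue_zero_le : |(1 - α) * B.discValue α 0| ≤ |B.lam| := by
  have h := (hB.discValue_spec hα hα1).2.2 0
  have hα' : 0 < 1 - α := sub_pos.mpr hα1
  rw [Nat.cast_zero, mul_zero, add_zero, le_div_iff₀ hα'] at h
  rwa [abs_mul, abs_of_pos hα', mul_comm]

/-- Reject at `x + 1`: with probability `1 - binWeight 0` the next state is at most `x`, and
otherwise it is `x + 1`. Replacing the factor `α` by 1 costs at most `|lam|`, hence the factor 2.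
The bound is uniform in `α`. -/
lemma discValue_succ_sub_le (x : ℕ) : B.discValue α (x + 1) - B.discValue α x ≤
    (B.C * (x + 1) + 2 * |B.lam|) / (1 - B.binWeight 0) := by
  obtain ⟨hmc, hbell, -⟩ := hB.discValue_spec hα hα1
  have hw : 0 < 1 - B.binWeight 0 := sub_pos.mpr hB.binWeight_zero_lt_one
  set W := B.discValue α
  have h1 : B.nextExp 0 W (x + 1) ≤
      B.binWeight 0 * W (x + 1) + (1 - B.binWeight 0) * W x := by
    have hsum := sum_binWeight (B := B)
    rw [nextExp_zero_eq, Finset.sum_range_succ']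
    rw [Finset.sum_range_succ'] at hsum
    have h2 : ∑ k ∈ Finset.range B.M, B.binWeight (k + 1) * W (x + 1 - (k + 1)) ≤
        ∑ k ∈ Finset.range B.M, B.binWeight (k + 1) * W x :=
      Finset.sum_le_sum fun k _ => mul_le_mul_of_nonneg_left (hmc.mono (by omega))
        (hB.binWeight_nonneg _)
    rw [← Finset.sum_mul, eq_sub_iff_add_eq.mpr hsum] at h2
    rw [Nat.sub_zero]
    linarith
  have h3 := bellman_le (B := B) α W (x + 1) 0
  rw [← hbell] at h3
  have h4 : W 0 ≤ B.nextExp 0 W (x + 1) := by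
    have := hB.nextExp_mono 0 (fun y => hmc.mono (Nat.zero_le y)) (x + 1)
    rwa [nextExp_const] at this
  have h5 := mul_le_mul_of_nonneg_left h4 (sub_pos.mpr hα1).le
  have h6 := (abs_le.mp (hB.abs_one_sub_mul_discValue_zero_le hα hα1)).1
  have h7 := le_abs_self B.lam
  rw [le_div_iff₀ hw]
  simp [cost] at h3
  linarith

lemma discValue_sub_bounds (x : ℕ) : 0 ≤ B.discValue α x - B.discValue α 0 ∧
    B.discValue α x - B.discValue α 0 ≤
      ∑ y ∈ Finset.range x, (B.C * (y + 1) + 2 * |B.lam|) / (1 - B.binWeight 0) := by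
  refine ⟨sub_nonneg.mpr ((hB.discValue_spec hα hα1).1.mono (Nat.zero_le x)), ?_⟩
  rw [← Finset.sum_range_sub]
  exact Finset.sum_le_sum fun y _ => hB.discValue_succ_sub_le hα hα1 y

/-- At most `M` users leave per slot, so coupled queues started at `x` and `x + 1` stay one apart
for `k` slots, and each slot costs an extra `C`. All discount factors are weakened to `α ^ k`. -/
lemma discValue_succ_sub_ge (k x : ℕ) (hx : k * B.M ≤ x) :
    B.C * k * α ^ k ≤ B.discValue α (x + 1) - B.discValue α x := by
  obtain ⟨hmc, hbell, -⟩ := hB.discValue_spec hα hα1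
  induction k generalizing x with
  | zero =>
    simpa using hmc.mono (Nat.le_succ x)
  | succ k ih =>
    have hC := hB.C_pos
    obtain ⟨u, hu⟩ := exists_bellman_eq (B := B) α (B.discValue α) (x + 1)
    have h1 := bellman_le (B := B) α (B.discValue α) x u
    rw [← hbell] at hu h1
    have h2 : B.C * k * α ^ k ≤
        B.nextExp u (B.discValue α) (x + 1) - B.nextExp u (B.discValue α) x := by
      -- Writing the constant as an expectation allows a termwise comparison.
      rw [← nextExp_const (B := B) u (B.C * k * α ^ k) 0]
      simp_rw [nextExp_eq, ← Finset.sum_sub_distrib, ← mul_sub]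
      refine Finset.sum_le_sum fun s _ => Finset.sum_le_sum fun d hd =>
        mul_le_mul_of_nonneg_left ?_ (mul_nonneg (hB.binWeight_nonneg d) (hB.arrProb_nonneg s))
      have hd' := Finset.mem_range.mp hd
      rw [Nat.succ_mul] at hx
      -- No truncation occurs here, since `d ≤ M ≤ x`.
      have h3 : x + 1 - d + (u : ℕ) * (s : ℕ) = x - d + (u : ℕ) * (s : ℕ) + 1 := by omega
      rw [h3]
      exact ih _ (by omega)
    have h4 := mul_le_mul_of_nonneg_left h2 hα
    have h5 : B.C * α ^ (k + 1) ≤ B.C * 1 :=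
      mul_le_mul_of_nonneg_left (pow_le_one₀ hα hα1.le) hC.le
    simp only [cost] at hu h1
    push_cast at hu h1 ⊢
    have h6 : B.C * (k + 1) * α ^ (k + 1) = B.C * α ^ (k + 1) + α * (B.C * k * α ^ k) := by ring
    linarith

end Discounted

end Admissible

end BaseStation

/-! ### Functions that are rational to the left of 1. -/

/-- `f` agrees with a rational function to the left of `1`. -/
def EventuallyRational (f : ℝ → ℝ) : Prop :=
  ∃ N Q : Polynomial ℝ, Q ≠ 0 ∧ ∀ᶠ α in 𝓝[<] (1 : ℝ), f α = N.eval α / Q.eval α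

lemma Polynomial.eventually_eval_ne_zero {Q : Polynomial ℝ} (hQ : Q ≠ 0) (a : ℝ) :
    ∀ᶠ α in 𝓝[<] a, Q.eval α ≠ 0 := by
  have hfin : ({α | Q.IsRoot α} \ {a} : Set ℝ).Finite :=
    (Polynomial.finite_setOfPred_isRoot hQ).subset Set.sdiff_subset
  have h : ({α | Q.IsRoot α} \ {a} : Set ℝ)ᶜ ∈ 𝓝 a :=
    hfin.isClosed.compl_mem_nhds fun h => h.2 rfl
  filter_upwards [nhdsWithin_le_nhds h, self_mem_nhdsWithin] with α h1 h2 h3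
  exact h1 ⟨h3, (Set.mem_Iio.mp h2).ne⟩

/-- A nonzero polynomial has no root in some interval `(l, a)`, so it cannot change sign there. -/
lemma Polynomial.eventually_eval_nonneg_or_nonpos (P : Polynomial ℝ) (a : ℝ) :
    (∀ᶠ α in 𝓝[<] a, 0 ≤ P.eval α) ∨ ∀ᶠ α in 𝓝[<] a, P.eval α ≤ 0 := by
  by_cases hP : P = 0
  · simp [hP]
  obtain ⟨l, hl, hsub⟩ := mem_nhdsLT_iff_exists_Ioo_subset.mp (P.eventually_eval_ne_zero hP a)
  have hmem : Set.Ioo l a ∈ 𝓝[<] a := Ioo_mem_nhdsLT hl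
  by_contra h
  simp only [not_or, Filter.not_eventually, not_le] at h
  obtain ⟨x, hx, hxm⟩ := (h.1.and_eventually hmem).exists
  obtain ⟨y, hy, hym⟩ := (h.2.and_eventually hmem).exists
  obtain ⟨z, hz, hz0⟩ := isPreconnected_Ioo.intermediate_value hxm hym
    P.continuous.continuousOn ⟨hx.le, hy.le⟩
  exact hsub hz hz0

namespace EventuallyRational

variable {f g : ℝ → ℝ}

lemma congr' (hf : EventuallyRational f) (h : f =ᶠ[𝓝[<] 1] g) : EventuallyRational g := by
  obtain ⟨N, Q, hQ, hN⟩ := hf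
  exact ⟨N, Q, hQ, by filter_upwards [hN, h] with α h1 h2; rw [← h2, h1]⟩

lemma eval (P : Polynomial ℝ) : EventuallyRational fun α => P.eval α :=
  ⟨P, 1, one_ne_zero, by simp⟩

lemma sub (hf : EventuallyRational f) (hg : EventuallyRational g) :
    EventuallyRational fun α => f α - g α := by
  obtain ⟨N, Q, hQ, hN⟩ := hf
  obtain ⟨N', Q', hQ', hN'⟩ := hg
  refine ⟨N * Q' - Q * N', Q * Q', mul_ne_zero hQ hQ', ?_⟩
  filter_upwards [hN, hN', Q.eventually_eval_ne_zero hQ 1, Q'.eventually_eval_ne_zero hQ' 1]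
    with α h1 h2 h3 h4
  rw [h1, h2, div_sub_div _ _ h3 h4]
  simp

lemma mul (hf : EventuallyRational f) (hg : EventuallyRational g) :
    EventuallyRational fun α => f α * g α := by
  obtain ⟨N, Q, hQ, hN⟩ := hf
  obtain ⟨N', Q', hQ', hN'⟩ := hg
  refine ⟨N * N', Q * Q', mul_ne_zero hQ hQ', ?_⟩
  filter_upwards [hN, hN'] with α h1 h2
  rw [h1, h2, div_mul_div_comm]
  simp

lemma nonneg_or_nonpos (hf : EventuallyRational f) :
    (∀ᶠ α in 𝓝[<] 1, 0 ≤ f α) ∨ ∀ᶠ α in 𝓝[<] 1, f α ≤ 0 := by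
  obtain ⟨N, Q, hQ, hN⟩ := hf
  have key (α : ℝ) : N.eval α / Q.eval α = (N * Q).eval α / (Q.eval α) ^ 2 := by
    rw [Polynomial.eval_mul, sq, mul_div_mul_comm]
    by_cases h : Q.eval α = 0
    · simp [h]
    · rw [div_self h, mul_one]
  refine ((N * Q).eventually_eval_nonneg_or_nonpos 1).imp (fun h => ?_) fun h => ?_
  · filter_upwards [h, hN] with α h1 h2
    rw [h2, key]
    exact div_nonneg h1 (sq_nonneg _)
  · filter_upwards [h, hN] with α h1 h2
    rw [h2, key]
    exact div_nonpos_of_nonpos_of_nonneg h1 (sq_nonneg _)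

lemma inf (hf : EventuallyRational f) (hg : EventuallyRational g) :
    EventuallyRational (f ⊓ g) := by
  rcases (hf.sub hg).nonneg_or_nonpos with h | h
  · exact hg.congr' (h.mono fun α hα => (min_eq_right (sub_nonneg.mp hα)).symm)
  · exact hf.congr' (h.mono fun α hα => (min_eq_left (sub_nonpos.mp hα)).symm)

/-- The pointwise least of finitely many eventually rational functions is eventually rational. -/
lemma of_finset {ι : Type*} (S : Finset ι) {F : ι → ℝ → ℝ}
    (hF : ∀ i ∈ S, EventuallyRational (F i))
    (h : ∀ᶠ α in 𝓝[<] 1, (∀ i ∈ S, f α ≤ F i α) ∧ ∃ i ∈ S, F i α = f α) :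
    EventuallyRational f := by
  obtain ⟨α, -, i, hi, -⟩ := h.exists
  have hS : S.Nonempty := ⟨i, hi⟩
  have hinf : EventuallyRational (S.inf' hS F) :=
    Finset.inf'_induction hS F (fun _ h1 _ h2 => h1.inf h2) hF
  refine hinf.congr' ?_
  filter_upwards [h] with α ⟨h1, j, hj, h2⟩
  rw [Finset.inf'_apply]
  exact le_antisymm ((Finset.inf'_le _ hj).trans_eq h2) (Finset.le_inf' _ _ h1)

/-- A bounded eventually rational function converges at `1` from the left: a rational function
cannot oscillate between two levels. -/
lemma exists_tendsto (hf : EventuallyRational f) {m M : ℝ}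
    (h : ∀ᶠ α in 𝓝[<] 1, m ≤ f α ∧ f α ≤ M) : ∃ c, Tendsto f (𝓝[<] 1) (𝓝 c) := by
  -- Being frequently below `a` and frequently above `b > a` would contradict the eventual sign of
  -- `f - a`.
  refine tendsto_of_no_upcrossings dense_univ (fun a _ b _ hab hfr => ?_)
    (isBoundedUnder_of_eventually_le (h.mono fun _ h => h.2))
    (isBoundedUnder_of_eventually_ge (h.mono fun _ h => h.1))
  have hconst : EventuallyRational fun _ => a := by simpa using eval (Polynomial.C a)
  rcases (hf.sub hconst).nonneg_or_nonpos with h1 | h1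
  · exact hfr.1 (h1.mono fun α hα => not_lt.mpr (sub_nonneg.mp hα))
  · exact hfr.2 (h1.mono fun α hα => not_lt.mpr ((sub_nonpos.mp hα).trans hab.le))

end EventuallyRational

/-- The solution of `v = c + α A v` is a rational function of `α`. -/
lemma eventuallyRational_of_affine_eq {n : Type*} [Fintype n] [DecidableEq n]
    (A : Matrix n n ℝ) (c : n → ℝ) {v : ℝ → n → ℝ}
    (h : ∀ᶠ α in 𝓝[<] 1, ∀ i, v α i = c i + α * (A.mulVec (v α)) i) (i : n) :
    EventuallyRational fun α => v α i := by
  let P : Matrix n n (Polynomial ℝ) := 1 - (Polynomial.X : Polynomial ℝ) • A.map Polynomial.C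
  have hP (α : ℝ) : (Polynomial.evalRingHom α).mapMatrix P = 1 - α • A := by
    ext i j
    by_cases hij : i = j <;> simp [P, hij, mul_comm α]
  have hdet (α : ℝ) : P.det.eval α = (1 - α • A).det := by
    rw [← hP, ← RingHom.map_det]; rfl
  have hadj (α : ℝ) (i j : n) : (P.adjugate i j).eval α = (1 - α • A).adjugate i j := by
    rw [← hP, ← RingHom.map_adjugate]; rfl
  -- At `α = 0` the matrix is the identity. Cramer's rule then applies wherever the determinant does
  -- not vanish.
  have hdet0 : P.det ≠ 0 := by
    intro h0
    have := hdet 0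
    simp [h0] at this
  refine ⟨∑ j, P.adjugate i j * Polynomial.C (c j), P.det, hdet0, ?_⟩
  filter_upwards [h, P.det.eventually_eval_ne_zero hdet0 1] with α h1 h2
  rw [eq_div_iff h2, Polynomial.eval_finsetSum]
  have hv : (1 - α • A).mulVec (v α) = c := by
    ext j
    rw [Matrix.sub_mulVec, Matrix.one_mulVec, Matrix.smul_mulVec, Pi.sub_apply, Pi.smul_apply,
      smul_eq_mul]
    linarith [h1 j]
  calc v α i * P.det.eval α = ((1 - α • A).det • v α) i := by
        rw [hdet, Pi.smul_apply, smul_eq_mul, mul_comm]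
    _ = ((1 - α • A).adjugate.mulVec c) i := by
        rw [← hv, Matrix.mulVec_mulVec, Matrix.adjugate_mul, Matrix.smul_mulVec, Matrix.one_mulVec]
    _ = _ := by
        simp only [Matrix.mulVec, dotProduct, Polynomial.eval_mul, Polynomial.eval_C, hadj]

/-! ### Rationality of the discounted values. -/

namespace BaseStation

variable {B : BaseStation}

lemma nextExp_sum {ι : Type*} (S : Finset ι) (F : ι → ℕ → ℝ) (u : Fin 2) (x : ℕ) :
    B.nextExp u (fun y => ∑ i ∈ S, F i y) x = ∑ i ∈ S, B.nextExp u (F i) x := by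
  simp_rw [nextExp_eq, Finset.mul_sum]
  rw [Finset.sum_comm (s := S)]
  refine Finset.sum_congr rfl fun s _ => ?_
  rw [Finset.sum_comm]

/-- The policy that plays `b` from state `K` on, and below `K` accepts in the states of `s`. -/
def tailPolicy (K : ℕ) (b : Fin 2) (s : Finset ℕ) (y : ℕ) : Fin 2 :=
  if y < K then if y ∈ s then 1 else 0 else b

lemma eventually_nhdsLT_one_mem : ∀ᶠ α in 𝓝[<] (1 : ℝ), 0 ≤ α ∧ α < 1 := by
  filter_upwards [Ioo_mem_nhdsLT (zero_lt_one (α := ℝ))] with α h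
  exact ⟨h.1.le, h.2⟩

namespace Admissible

variable (hB : B.Admissible)
include hB

/-- The states `0, ..., N` are closed under the chain, so policy evaluation there is a finite linear
system. -/
lemma discCost_eventuallyRational_of_le {π : ℕ → Fin 2} {N : ℕ}
    (hπ : π N = 0 ∨ B.p = 0) {x : ℕ} (hx : x ≤ N) :
    EventuallyRational fun α => B.discCost α π x := by
  refine eventuallyRational_of_affine_eq (n := Fin (N + 1))
    (Matrix.of fun i j => B.nextExp (π i) (fun y => if y = (j : ℕ) then 1 else 0) i)
    (fun i => B.cost i (π i)) (v := fun α i => B.discCost α π i) ?_ ⟨x, Nat.lt_succ_of_le hx⟩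
  filter_upwards [eventually_nhdsLT_one_mem] with α hα i
  rw [hB.discCost_eq hα.1 hα.2]
  congr 2
  simp only [Matrix.mulVec, dotProduct, Matrix.of_apply]
  simp_rw [mul_comm (B.nextExp _ _ _), ← nextExp_const_mul, ← nextExp_sum]
  refine nextExp_congr (Nat.le_of_lt_succ i.2) (fun h => by rwa [h]) fun y hy => ?_
  rw [Finset.sum_eq_single (⟨y, Nat.lt_succ_of_le hy⟩ : Fin (N + 1))]
  · simp
  · intro j _ hj
    rw [if_neg fun h => hj (Fin.ext h.symm), mul_zero]
  · simp

lemma discCost_tailPolicy_eventuallyRational {K : ℕ} {b : Fin 2} (hb : b = 0 ∨ B.p = 0)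
    (s : Finset ℕ) (x : ℕ) : EventuallyRational fun α => B.discCost α (tailPolicy K b s) x :=
  hB.discCost_eventuallyRational_of_le (N := max K x)
    (by rwa [tailPolicy, if_neg (not_lt.mpr (le_max_left K x))]) (le_max_right K x)

lemma le_nextExp_one_sub_zero {α : ℝ} (hα : 0 ≤ α) (hα1 : α < 1) {k x : ℕ}
    (hx : (k + 1) * B.M ≤ x) : B.p * (B.C * k * α ^ k) ≤
      B.nextExp 1 (B.discValue α) x - B.nextExp 0 (B.discValue α) x := by
  rw [nextExp_one_sub_zero]
  refine mul_le_mul_of_nonneg_left ?_ hB.p_nonneg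
  rw [← one_mul (B.C * k * α ^ k), ← sum_binWeight (B := B), Finset.sum_mul]
  refine Finset.sum_le_sum fun d hd => mul_le_mul_of_nonneg_left ?_ (hB.binWeight_nonneg d)
  have hd' := Finset.mem_range.mp hd
  rw [Nat.succ_mul] at hx
  exact hB.discValue_succ_sub_ge hα hα1 k _ (by omega)

/-- Far from the origin one action is optimal for all discount factors close to `1`. -/
lemma exists_tail_action : ∃ (K : ℕ) (b : Fin 2), (b = 0 ∨ B.p = 0) ∧
    ∀ᶠ α in 𝓝[<] 1, ∀ x, K ≤ x →
      B.discValue α x = B.cost x b + α * B.nextExp b (B.discValue α) x := by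
  rcases hB.p_nonneg.eq_or_lt with hp | hp
  · have heq (f : ℕ → ℝ) (x : ℕ) : B.nextExp 1 f x = B.nextExp 0 f x := by
      have := nextExp_one_sub_zero (B := B) f x
      rw [← hp, zero_mul] at this
      linarith
    rcases le_total 0 B.lam with hl | hl
    · refine ⟨0, 1, Or.inr hp.symm, ?_⟩
      filter_upwards [eventually_nhdsLT_one_mem] with α hα x _
      rw [(hB.discValue_spec hα.1 hα.2).2.1 x, bellman, min_eq_left (by rw [heq]; linarith)]
      simp [cost]
    · refine ⟨0, 0, Or.inl rfl, ?_⟩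
      filter_upwards [eventually_nhdsLT_one_mem] with α hα x _
      rw [(hB.discValue_spec hα.1 hα.2).2.1 x, bellman, min_eq_right (by rw [heq]; linarith)]
      simp [cost]
      ring
  · have hpC : 0 < B.p * B.C := mul_pos hp hB.C_pos
    -- Beyond `(k + 1) M` accepting adds at least `α p C k α ^ k` in expected future cost. This
    -- tends to `p C k > lam` as `α ↑ 1`, so the threshold can be fixed before `α`.
    obtain ⟨k, hk⟩ := exists_nat_gt (B.lam / (B.p * B.C))
    rw [div_lt_iff₀ hpC] at hk
    refine ⟨(k + 1) * B.M, 0, Or.inl rfl, ?_⟩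
    have hlim : Tendsto (fun α : ℝ => α * (B.p * (B.C * k * α ^ k))) (𝓝[<] 1)
        (𝓝 (1 * (B.p * (B.C * k * 1 ^ k)))) :=
      (Continuous.tendsto (by fun_prop) 1).mono_left nhdsWithin_le_nhds
    filter_upwards [eventually_nhdsLT_one_mem,
      hlim.eventually_const_lt (u := B.lam) (by rw [one_pow]; linarith)] with α hα hlam x hx
    have h1 := mul_le_mul_of_nonneg_left (hB.le_nextExp_one_sub_zero hα.1 hα.2 hx) hα.1
    rw [(hB.discValue_spec hα.1 hα.2).2.1 x, bellman, min_eq_right (by linarith)]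
    simp [cost]
    ring

lemma discValue_eventuallyRational (x : ℕ) : EventuallyRational fun α => B.discValue α x := by
  obtain ⟨K, b, hb, h⟩ := hB.exists_tail_action
  refine EventuallyRational.of_finset (Finset.range K).powerset
    (F := fun s α => B.discCost α (tailPolicy K b s) x)
    (fun s _ => hB.discCost_tailPolicy_eventuallyRational hb s x) ?_
  filter_upwards [eventually_nhdsLT_one_mem, h] with α hα htail
  refine ⟨fun s _ => hB.discValue_le_discCost hα.1 hα.2 _ x, ?_⟩
  choose π hπ using exists_bellman_eq (B := B) α (B.discValue α)
  -- Only this set varies with `α`: below `K` the policy is greedy, and from `K` on `b` is optimal.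
  refine ⟨(Finset.range K).filter fun y => π y = 1,
    Finset.mem_powerset.mpr (Finset.filter_subset _ _),
    hB.discCost_eq_discValue hα.1 hα.2 (fun y => ?_) x⟩
  by_cases hy : y < K
  · have : tailPolicy K b ((Finset.range K).filter fun y => π y = 1) y = π y := by
      rcases Fin.exists_fin_two.mp ⟨π y, rfl⟩ with h0 | h1
      · simp +decide [tailPolicy, hy, show π y = 0 from h0]
      · simp +decide [tailPolicy, hy, show π y = 1 from h1]
    rw [this, ← hπ, ← (hB.discValue_spec hα.1 hα.2).2.1]
  · rw [tailPolicy, if_neg hy]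
    exact htail y (not_lt.mp hy)

/-! ### Passage to the limit `α ↑ 1`. -/

lemma tendsto_relValue (x : ℕ) :
    Tendsto (fun α : ℝ => B.discValue α x - B.discValue α 0) (𝓝[<] 1) (𝓝 (B.relValue x)) :=
  tendsto_nhds_limUnder <|
    ((hB.discValue_eventuallyRational x).sub (hB.discValue_eventuallyRational 0)).exists_tendsto
      (eventually_nhdsLT_one_mem.mono fun _ hα => hB.discValue_sub_bounds hα.1 hα.2 x)

lemma tendsto_eta : Tendsto (fun α : ℝ => (1 - α) * B.discValue α 0) (𝓝[<] 1) (𝓝 B.eta) := by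
  have h1 : EventuallyRational fun α : ℝ => 1 - α :=
    (EventuallyRational.eval (1 - Polynomial.X)).congr' (.of_forall fun α => by simp)
  exact tendsto_nhds_limUnder <|
    (h1.mul (hB.discValue_eventuallyRational 0)).exists_tendsto
      (eventually_nhdsLT_one_mem.mono fun _ hα =>
        abs_le.mp (hB.abs_one_sub_mul_discValue_zero_le hα.1 hα.2))

lemma solvesDPE : B.SolvesDPE B.relValue B.eta := by
  intro x
  refine tendsto_nhds_unique (hB.tendsto_relValue x) ?_
  have hid : Tendsto (fun α : ℝ => α) (𝓝[<] 1) (𝓝 1) := nhdsWithin_le_nhds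
  have hu (u : Fin 2) := hid.mul (nextExp_tendsto (B := B) hB.tendsto_relValue u x)
  -- Subtracting `V^α(0)` from the Bellman equation, with `α V^α(0)` moved inside the minimum,
  -- leaves `-(1 - α) V^α(0)`, the source of `-η`. Each expectation is a finite sum, so pointwise
  -- convergence suffices.
  have h := (hB.tendsto_eta.const_sub (B.C * x)).add ((hu 1).min ((hu 0).const_add B.lam))
  rw [one_mul, one_mul] at h
  refine h.congr' ?_
  filter_upwards [eventually_nhdsLT_one_mem] with α hα
  rw [nextExp_sub, nextExp_sub, nextExp_const, nextExp_const,
    (hB.discValue_spec hα.1 hα.2).2.1 x, bellman, mul_sub, mul_sub, ← add_sub_assoc,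
    min_sub_sub_right]
  ring

lemma relValue_incr_monotone : Monotone fun x => B.relValue (x + 1) - B.relValue x := by
  intro x y hxy
  refine le_of_tendsto_of_tendsto
    ((hB.tendsto_relValue (x + 1)).sub (hB.tendsto_relValue x))
    ((hB.tendsto_relValue (y + 1)).sub (hB.tendsto_relValue y)) ?_
  filter_upwards [eventually_nhdsLT_one_mem] with α hα
  have := (hB.discValue_spec hα.1 hα.2).1.incr hxy
  simp only at this
  linarith

end Admissible

end BaseStation

lemma Monotone.sub_le_sub_of_incr {f : ℕ → ℝ} (hf : Monotone fun x => f (x + 1) - f x)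
    {x y : ℕ} (hxy : x ≤ y) (z : ℕ) : f (x + z) - f x ≤ f (y + z) - f y := by
  induction z with
  | zero => simp
  | succ z ih =>
    have := hf (show x + z ≤ y + z by omega)
    simp only [add_assoc] at this
    linarith

theorem lemma3 (B : BaseStation) (hM : 1 ≤ B.M) (hp0 : 0 ≤ B.p) (hp1 : B.p ≤ 1)
    (hq0 : 0 < B.q) (hq1 : B.q < 1) (hr0 : 0 ≤ B.r) (hrr' : B.r < B.r') (hr'1 : B.r' ≤ 1)
    (hC : 0 < B.C) :
    (∀ x : ℕ, Tendsto (fun α : ℝ => B.discValue α x - B.discValue α 0) (𝓝[<] 1)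
      (𝓝 (B.relValue x))) ∧
    Tendsto (fun α : ℝ => (1 - α) * B.discValue α 0) (𝓝[<] 1) (𝓝 B.eta) ∧
    B.SolvesDPE B.relValue B.eta ∧
    ∀ z x₁ x₂ : ℕ, 0 < z → x₂ < x₁ →
      B.relValue (x₂ + z) - B.relValue x₂ ≤ B.relValue (x₁ + z) - B.relValue x₁ := by
  have hB : B.Admissible :=
    ⟨hM, hp0, hp1, hq0.le, hq1, hr0, hrr'.le.trans hr'1, hr0.trans_lt hrr', hr'1, hC⟩
  exact ⟨hB.tendsto_relValue, hB.tendsto_eta, hB.solvesDPE, fun z _ _ _ hx =>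
    hB.relValue_incr_monotone.sub_le_sub_of_incr hx.le z⟩
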